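/- Let $K$ be a field, let $m\ge 2$ and $n\ge 3$ be integers, and let $q\in K$ be a primitive $m$-th root of unity (i.e. of exact multiplicative order $m$). For $\beta,\sigma\in K$ with $\beta^2=1$ and $\sigma^{\gcd(n,n-2)}=1$, let $T^{\beta,\sigma}_{2nm^2}(q)$ be the Hopf algebra over $K$ generated as an algebra by $c,d,h,x$ subject to the relations $$c^2=d^n=h^m=1,\quad x^m=0,\quad ch=hc,\quad dh=hd,\quad cd=d^{\,n-1}c,\quad cx=\beta\,xc,\quad dx=\sigma\,xd,\quad xh=q\,hx,$$ with coalgebra structure and antipode determined by $$\Delta(c)=c\otimes c,\quad \Delta(d)=d\otimes d,\quad \Delta(h)=h\otimes h,\quad \Delta(x)=x\otimes h+1\otimes x,$$ $$\varepsilon(c)=\varepsilon(d)=\varepsilon(h)=1,\quad \varepsilon(x)=0,\quad S(c)=c,\quad S(d)=d^{\,n-1},\quad S(h)=h^{m-1},\quad S(x)=-xh^{m-1}.$$ Let $\beta,\overline\beta,\sigma,\overline\sigma\in K$ satisfy $\beta^2=\overline\beta^{\,2}=1$ and $\sigma^{\gcd(n,n-2)}=\overline\sigma^{\,\gcd(n,n-2)}=1$.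 **Theorem.** The Hopf algebras $T^{\beta,\sigma}_{2nm^2}(q)$ and $T^{\overline\beta,\overline\sigma}_{2nm^2}(q)$ are isomorphic if and only if there exist integers $f,F\in\{0,1,\dots,m-1\}$ and $s,t\in\{0,1,\dots,n-1\}$ with $\gcd(t,n)=1$ such that $$m\mid 2f,\qquad m\mid nF,\qquad m\mid 2F,$$ $$q^f=\beta\,\overline\beta\,\overline\sigma^{\,s},\qquad q^F=\sigma\,\overline\sigma^{\,t}.$$ -/

import Mathlib

open scoped TensorProduct

namespace TaftDihedral

section QBinomial

/-- The Gaussian binomial coefficients, through the `q`-Pascal rule. -/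
def qChoose {K : Type*} [CommRing K] (q : K) : ℕ → ℕ → K
  | _, 0 => 1
  | 0, _ + 1 => 0
  | k + 1, i + 1 => qChoose q k i + q ^ (i + 1) * qChoose q k (i + 1)

theorem qChoose_zero_right {K : Type*} [CommRing K] (q : K) (k : ℕ) : qChoose q k 0 = 1 := by
  cases k <;> rfl

theorem qChoose_succ_succ {K : Type*} [CommRing K] (q : K) (k i : ℕ) :
    qChoose q (k + 1) (i + 1) = qChoose q k i + q ^ (i + 1) * qChoose q k (i + 1) := rfl

theorem qChoose_eq_zero {K : Type*} [CommRing K] (q : K) :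
    ∀ k i : ℕ, k < i → qChoose q k i = 0
  | 0, i + 1, _ => rfl
  | k + 1, i + 1, h => by
    rw [qChoose_succ_succ, qChoose_eq_zero q k i (by omega),
      qChoose_eq_zero q k (i + 1) (by omega)]
    simp

theorem qChoose_rec {K : Type*} [CommRing K] (q : K) (k : ℕ) : ∀ i : ℕ,
    q ^ i * (1 - q ^ (i + 1)) * qChoose q k (i + 1) = (q ^ i - q ^ k) * qChoose q k i := by
  induction k with
  | zero =>
    intro i
    cases i with
    | zero => simp [qChoose]
    | succ i => simp [qChoose]
  | succ k ih =>
    intro i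
    cases i with
    | zero =>
      have h := ih 0
      rw [qChoose_succ_succ]
      simp only [qChoose_zero_right] at h ⊢
      linear_combination q * h
    | succ j =>
      have h1 := ih (j + 1)
      have h2 := ih j
      rw [qChoose_succ_succ q k (j + 1), qChoose_succ_succ q k j]
      linear_combination q ^ (j + 2) * h1 + q * h2

theorem qChoose_root_eq_zero {K : Type*} [Field K] {q : K} {m : ℕ} (hq : IsPrimitiveRoot q m)
    (hm : m ≠ 0) (i : ℕ) (hi : i + 1 < m) : qChoose q m (i + 1) = 0 := by
  have hq0 : q ≠ 0 := hq.ne_zero hm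
  have key : ∀ i, i + 1 < m → (q ^ i - 1) * qChoose q m i = 0 → qChoose q m (i + 1) = 0 := by
    intro i hi h
    have h1 := qChoose_rec q m i
    rw [hq.pow_eq_one, h] at h1
    have h2 : (1 - q ^ (i + 1)) ≠ 0 :=
      sub_ne_zero.mpr (hq.pow_ne_one_of_pos_of_lt (Nat.succ_ne_zero i) hi).symm
    simpa [hq0, h2] using h1
  induction i with
  | zero => exact key 0 hi (by simp)
  | succ j ih => exact key (j + 1) hi (by rw [ih (by omega), mul_zero])

theorem mul_pow_qComm {K A : Type*} [CommRing K] [Ring A] [Algebra K A] (q : K) (X Y : A)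
    (h : Y * X = q • (X * Y)) (i : ℕ) : Y * X ^ i = q ^ i • (X ^ i * Y) := by
  induction i with
  | zero => simp
  | succ i ih =>
    rw [pow_succ, ← mul_assoc, ih, smul_mul_assoc, mul_assoc, h, mul_smul_comm, smul_smul,
      ← pow_succ, mul_assoc]

theorem add_pow_qComm {K A : Type*} [CommRing K] [Ring A] [Algebra K A] (q : K) (X Y : A)
    (h : Y * X = q • (X * Y)) (k : ℕ) :
    (X + Y) ^ k = ∑ i ∈ Finset.range (k + 1), qChoose q k i • (X ^ i * Y ^ (k - i)) := by
  induction k with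
  | zero => simp [qChoose]
  | succ k ih =>
    have e2 : Y * ∑ i ∈ Finset.range (k + 1), qChoose q k i • (X ^ i * Y ^ (k - i)) =
        ∑ i ∈ Finset.range (k + 1), (q ^ i * qChoose q k i) • (X ^ i * Y ^ (k + 1 - i)) := by
      rw [Finset.mul_sum]
      refine Finset.sum_congr rfl fun i hi => ?_
      have hi' : k + 1 - i = (k - i) + 1 := by
        have := Finset.mem_range.mp hi
        omega
      rw [mul_smul_comm, ← mul_assoc, mul_pow_qComm q X Y h, smul_mul_assoc, smul_smul, hi',
        pow_succ' Y, mul_assoc, mul_comm (q ^ i)]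
    have e3 : ∑ i ∈ Finset.range (k + 1), (q ^ i * qChoose q k i) • (X ^ i * Y ^ (k + 1 - i)) =
        ∑ i ∈ Finset.range (k + 1),
          (q ^ (i + 1) * qChoose q k (i + 1)) • (X ^ (i + 1) * Y ^ (k - i)) + Y ^ (k + 1) := by
      rw [Finset.sum_range_succ', Finset.sum_range_succ _ k, qChoose_eq_zero q k (k + 1) (by omega)]
      simp [qChoose_zero_right]
    rw [pow_succ', ih, add_mul, e2, e3, Finset.sum_range_succ' _ (k + 1), Finset.mul_sum,
      ← add_assoc, ← Finset.sum_add_distrib]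
    congr 1
    · refine Finset.sum_congr rfl fun i _ => ?_
      rw [qChoose_succ_succ, add_smul, mul_smul_comm, ← mul_assoc, ← pow_succ',
        Nat.add_sub_add_right]
    · simp [qChoose_zero_right]

theorem add_pow_qComm_eq_zero {K A : Type*} [Field K] [Ring A] [Algebra K A] {q : K} {m : ℕ}
    (hq : IsPrimitiveRoot q m) (hm : m ≠ 0) (X Y : A) (h : Y * X = q • (X * Y))
    (hX : X ^ m = 0) (hY : Y ^ m = 0) : (X + Y) ^ m = 0 := by
  rw [add_pow_qComm q X Y h]
  refine Finset.sum_eq_zero fun i hi => ?_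
  rcases i with _ | i
  · simp [hY]
  · rcases Nat.lt_or_ge (i + 1) m with h1 | h1
    · rw [qChoose_root_eq_zero hq hm i h1, zero_smul]
    · have : i + 1 = m := by
        have := Finset.mem_range.mp hi
        omega
      rw [this, hX, zero_mul, smul_zero]

end QBinomial

/-- The four algebra generators. -/
inductive Gen : Type
  | c | d | h | x

open Gen in
/-- The defining relations: `c, d` generate the dihedral group of order `2n`, `h, x` generate the
Taft algebra of dimension `m²`, and `c, d` commute with `h` and `q`-commute with `x` through the
scalars `β, σ`. -/
inductive Rel {K : Type*} [Field K] (m n : ℕ) (q β σ : K) :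
    FreeAlgebra K Gen → FreeAlgebra K Gen → Prop
  | c_pow : Rel m n q β σ (FreeAlgebra.ι K c ^ 2) 1
  | d_pow : Rel m n q β σ (FreeAlgebra.ι K d ^ n) 1
  | h_pow : Rel m n q β σ (FreeAlgebra.ι K h ^ m) 1
  | x_pow : Rel m n q β σ (FreeAlgebra.ι K x ^ m) 0
  | c_h : Rel m n q β σ (FreeAlgebra.ι K c * FreeAlgebra.ι K h)
      (FreeAlgebra.ι K h * FreeAlgebra.ι K c)
  | d_h : Rel m n q β σ (FreeAlgebra.ι K d * FreeAlgebra.ι K h)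
      (FreeAlgebra.ι K h * FreeAlgebra.ι K d)
  | c_d : Rel m n q β σ (FreeAlgebra.ι K c * FreeAlgebra.ι K d)
      (FreeAlgebra.ι K d ^ (n - 1) * FreeAlgebra.ι K c)
  | c_x : Rel m n q β σ (FreeAlgebra.ι K c * FreeAlgebra.ι K x)
      (β • (FreeAlgebra.ι K x * FreeAlgebra.ι K c))
  | d_x : Rel m n q β σ (FreeAlgebra.ι K d * FreeAlgebra.ι K x)
      (σ • (FreeAlgebra.ι K x * FreeAlgebra.ι K d))
  | x_h : Rel m n q β σ (FreeAlgebra.ι K x * FreeAlgebra.ι K h)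
      (q • (FreeAlgebra.ι K h * FreeAlgebra.ι K x))

end TaftDihedral

open TaftDihedral in
/-- The algebra `T^{β,σ}_{2nm²}(q)` presented by generators `c, d, h, x` and the relations above.
The standing assumptions on `m`, `n`, `q` are arguments, so that its Hopf algebra structure below
is an instance. -/
def TaftDihedral {K : Type*} [Field K] {m n : ℕ} {q : K} (_hm : 2 ≤ m) (_hn : 3 ≤ n)
    (_hq : IsPrimitiveRoot q m) (β σ : K) : Type _ :=
  RingQuot (Rel m n q β σ)

namespace TaftDihedral

noncomputable section

instance instRing {K : Type*} [Field K] {m n : ℕ} {q : K} (hm : 2 ≤ m) (hn : 3 ≤ n)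
    (hq : IsPrimitiveRoot q m) (β σ : K) : Ring (TaftDihedral hm hn hq β σ) :=
  inferInstanceAs (Ring (RingQuot (Rel m n q β σ)))

instance instAlgebra {K : Type*} [Field K] {m n : ℕ} {q : K} (hm : 2 ≤ m) (hn : 3 ≤ n)
    (hq : IsPrimitiveRoot q m) (β σ : K) : Algebra K (TaftDihedral hm hn hq β σ) :=
  inferInstanceAs (Algebra K (RingQuot (Rel m n q β σ)))

variable {K : Type*} [Field K] {m n : ℕ} {q : K} (hm : 2 ≤ m) (hn : 3 ≤ n)
    (hq : IsPrimitiveRoot q m) (β σ : K)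

/-- The projection from the free algebra. -/
def proj : FreeAlgebra K Gen →ₐ[K] TaftDihedral hm hn hq β σ :=
  RingQuot.mkAlgHom K (Rel m n q β σ)

theorem proj_rel {a b : FreeAlgebra K Gen} (h : Rel m n q β σ a b) :
    proj hm hn hq β σ a = proj hm hn hq β σ b :=
  RingQuot.mkAlgHom_rel K h

/-- The class of a generator in the presented algebra. -/
def of (g : Gen) : TaftDihedral hm hn hq β σ :=
  proj hm hn hq β σ (FreeAlgebra.ι K g)

/-- A choice of images of the generators that satisfies the defining relations. -/
structure Respects (m n : ℕ) (q β σ : K) {B : Type*} [Ring B] [Algebra K B]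
    (F : Gen → B) : Prop where
  c_pow : F .c ^ 2 = 1
  d_pow : F .d ^ n = 1
  h_pow : F .h ^ m = 1
  x_pow : F .x ^ m = 0
  c_h : F .c * F .h = F .h * F .c
  d_h : F .d * F .h = F .h * F .d
  c_d : F .c * F .d = F .d ^ (n - 1) * F .c
  c_x : F .c * F .x = β • (F .x * F .c)
  d_x : F .d * F .x = σ • (F .x * F .d)
  x_h : F .x * F .h = q • (F .h * F .x)

theorem respects_of : Respects m n q β σ (of hm hn hq β σ) where
  c_pow := by simpa only [map_pow, map_one, of] using proj_rel hm hn hq β σ Rel.c_pow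
  d_pow := by simpa only [map_pow, map_one, of] using proj_rel hm hn hq β σ Rel.d_pow
  h_pow := by simpa only [map_pow, map_one, of] using proj_rel hm hn hq β σ Rel.h_pow
  x_pow := by simpa only [map_pow, map_zero, of] using proj_rel hm hn hq β σ Rel.x_pow
  c_h := by simpa only [map_mul, of] using proj_rel hm hn hq β σ Rel.c_h
  d_h := by simpa only [map_mul, of] using proj_rel hm hn hq β σ Rel.d_h
  c_d := by simpa only [map_mul, map_pow, of] using proj_rel hm hn hq β σ Rel.c_d
  c_x := by simpa only [map_mul, map_smul, of] using proj_rel hm hn hq β σ Rel.c_x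
  d_x := by simpa only [map_mul, map_smul, of] using proj_rel hm hn hq β σ Rel.d_x
  x_h := by simpa only [map_mul, map_smul, of] using proj_rel hm hn hq β σ Rel.x_h

variable {β σ} in
/-- The universal property of the presentation. -/
def lift {B : Type*} [Ring B] [Algebra K B] (F : Gen → B) (hF : Respects m n q β σ F) :
    TaftDihedral hm hn hq β σ →ₐ[K] B :=
  RingQuot.liftAlgHom K ⟨FreeAlgebra.lift K F, by
    intro a b hab
    cases hab <;> simp only [map_pow, map_mul, map_one, map_zero, map_smul, FreeAlgebra.lift_ι_apply]
    exacts [hF.c_pow, hF.d_pow, hF.h_pow, hF.x_pow, hF.c_h, hF.d_h, hF.c_d, hF.c_x, hF.d_x,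
      hF.x_h]⟩

variable {β σ} in
@[simp]
theorem lift_of {B : Type*} [Ring B] [Algebra K B] (F : Gen → B) (hF : Respects m n q β σ F)
    (g : Gen) : lift hm hn hq F hF (of hm hn hq β σ g) = F g := by
  unfold lift of proj
  exact (RingQuot.liftAlgHom_mkAlgHom_apply K (FreeAlgebra.lift K F) _ _).trans
    (FreeAlgebra.lift_ι_apply F g)

variable {hm hn hq β σ} in
theorem algHom_ext {B : Type*} [Ring B] [Algebra K B] {f g : TaftDihedral hm hn hq β σ →ₐ[K] B}
    (h : ∀ i, f (of hm hn hq β σ i) = g (of hm hn hq β σ i)) : f = g :=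
  RingQuot.ringQuot_ext' (S := K) (s := Rel m n q β σ) f g (FreeAlgebra.hom_ext (funext h))

variable {hm hn hq β σ} in
theorem induction {P : TaftDihedral hm hn hq β σ → Prop}
    (algebraMap : ∀ r : K, P (algebraMap K _ r)) (of : ∀ g, P (of hm hn hq β σ g))
    (mul : ∀ a b, P a → P b → P (a * b)) (add : ∀ a b, P a → P b → P (a + b))
    (a : TaftDihedral hm hn hq β σ) : P a := by
  obtain ⟨y, rfl⟩ := (RingQuot.mkAlgHom_surjective K (Rel m n q β σ) :
    Function.Surjective (proj hm hn hq β σ)) a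
  induction y using FreeAlgebra.induction with
  | grade0 r =>
    rw [AlgHom.commutes]
    exact algebraMap r
  | grade1 g => exact of g
  | mul a b ha hb => rw [map_mul]; exact mul _ _ ha hb
  | add a b ha hb => rw [map_add]; exact add _ _ ha hb

/-- The comultiplication on generators: `c, d, h` are group-like and `Δ(x) = x ⊗ h + 1 ⊗ x`. -/
def comulGen : Gen → TaftDihedral hm hn hq β σ ⊗[K] TaftDihedral hm hn hq β σ
  | .c => of hm hn hq β σ .c ⊗ₜ of hm hn hq β σ .c
  | .d => of hm hn hq β σ .d ⊗ₜ of hm hn hq β σ .d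
  | .h => of hm hn hq β σ .h ⊗ₜ of hm hn hq β σ .h
  | .x => of hm hn hq β σ .x ⊗ₜ of hm hn hq β σ .h + 1 ⊗ₜ of hm hn hq β σ .x

theorem respects_comulGen : Respects m n q β σ (comulGen hm hn hq β σ) := by
  have R := respects_of hm hn hq β σ
  refine ⟨?_, ?_, ?_, ?_, ?_, ?_, ?_, ?_, ?_, ?_⟩ <;> simp only [comulGen]
  · rw [Algebra.TensorProduct.tmul_pow, R.c_pow, Algebra.TensorProduct.one_def]
  · rw [Algebra.TensorProduct.tmul_pow, R.d_pow, Algebra.TensorProduct.one_def]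
  · rw [Algebra.TensorProduct.tmul_pow, R.h_pow, Algebra.TensorProduct.one_def]
  · refine add_pow_qComm_eq_zero hq (by omega) _ _ ?_ ?_ ?_
    · simp only [Algebra.TensorProduct.tmul_mul_tmul, one_mul, mul_one, R.x_h,
        TensorProduct.tmul_smul]
    · rw [Algebra.TensorProduct.tmul_pow, R.x_pow, TensorProduct.zero_tmul]
    · rw [Algebra.TensorProduct.tmul_pow, R.x_pow, TensorProduct.tmul_zero]
  · simp only [Algebra.TensorProduct.tmul_mul_tmul, R.c_h]
  · simp only [Algebra.TensorProduct.tmul_mul_tmul, R.d_h]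
  · simp only [Algebra.TensorProduct.tmul_pow, Algebra.TensorProduct.tmul_mul_tmul, R.c_d]
  · simp only [mul_add, add_mul, Algebra.TensorProduct.tmul_mul_tmul, R.c_x, R.c_h, one_mul,
      mul_one, TensorProduct.tmul_smul, ← TensorProduct.smul_tmul', smul_add]
  · simp only [mul_add, add_mul, Algebra.TensorProduct.tmul_mul_tmul, R.d_x, R.d_h, one_mul,
      mul_one, TensorProduct.tmul_smul, ← TensorProduct.smul_tmul', smul_add]
  · simp only [mul_add, add_mul, Algebra.TensorProduct.tmul_mul_tmul, R.x_h, one_mul,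
      mul_one, TensorProduct.tmul_smul, ← TensorProduct.smul_tmul', smul_add]

/-- The counit on generators: `ε(c) = ε(d) = ε(h) = 1`, `ε(x) = 0`. -/
def counitGen (K : Type*) [Field K] : Gen → K
  | .c => 1
  | .d => 1
  | .h => 1
  | .x => 0

theorem respects_counitGen (n : ℕ) (q β σ : K) (hm : 2 ≤ m) :
    Respects m n q β σ (counitGen K) := by
  have : m ≠ 0 := by omega
  constructor <;> simp [counitGen, this]

/-- The antipode on generators: `S(c) = c`, `S(d) = d^{n-1}`, `S(h) = h^{m-1}`,
`S(x) = -x h^{m-1}`. -/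
def antipodeGen : Gen → TaftDihedral hm hn hq β σ
  | .c => of hm hn hq β σ .c
  | .d => of hm hn hq β σ .d ^ (n - 1)
  | .h => of hm hn hq β σ .h ^ (m - 1)
  | .x => -(of hm hn hq β σ .x * of hm hn hq β σ .h ^ (m - 1))

theorem mul_pow_of_qComm {K A : Type*} [CommRing K] [Ring A] [Algebra K A] (r : K) (x g : A)
    (h : g * x = r • (x * g)) (k : ℕ) : ∃ s : K, (x * g) ^ k = s • (x ^ k * g ^ k) := by
  induction k with
  | zero => exact ⟨1, by simp⟩
  | succ k ih =>
    obtain ⟨s, hs⟩ := ih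
    refine ⟨s * r ^ k, ?_⟩
    have key : x * g * x ^ k = r ^ k • (x ^ (k + 1) * g) := by
      rw [mul_assoc, mul_pow_qComm r x g h, mul_smul_comm, ← mul_assoc, ← pow_succ']
    rw [pow_succ', hs, mul_smul_comm, ← mul_assoc, key, smul_mul_assoc, smul_smul, mul_assoc,
      ← pow_succ']

open MulOpposite in
theorem respects_antipodeGen :
    Respects m n q β σ (fun g => op (antipodeGen hm hn hq β σ g)) := by
  have R := respects_of hm hn hq β σ
  have hm1 : m - 1 + 1 = m := by omega
  have hn1 : n - 1 + 1 = n := by omega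
  have hhH : of hm hn hq β σ .h * of hm hn hq β σ .h ^ (m - 1) = 1 := by
    rw [← pow_succ', hm1, R.h_pow]
  have hHh : of hm hn hq β σ .h ^ (m - 1) * of hm hn hq β σ .h = 1 := by
    rw [← pow_succ, hm1, R.h_pow]
  have hdD : of hm hn hq β σ .d * of hm hn hq β σ .d ^ (n - 1) = 1 := by
    rw [← pow_succ', hn1, R.d_pow]
  have hDd : of hm hn hq β σ .d ^ (n - 1) * of hm hn hq β σ .d = 1 := by
    rw [← pow_succ, hn1, R.d_pow]
  have hcc : of hm hn hq β σ .c * of hm hn hq β σ .c = 1 := by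
    rw [← pow_two, R.c_pow]
  have hHm : (of hm hn hq β σ .h ^ (m - 1)) ^ m = 1 := by
    rw [← pow_mul, mul_comm, pow_mul, R.h_pow, one_pow]
  have hDn : (of hm hn hq β σ .d ^ (n - 1)) ^ n = 1 := by
    rw [← pow_mul, mul_comm, pow_mul, R.d_pow, one_pow]
  have hcH : of hm hn hq β σ .c * of hm hn hq β σ .h ^ (m - 1) =
      of hm hn hq β σ .h ^ (m - 1) * of hm hn hq β σ .c :=
    ((show Commute _ _ from R.c_h).pow_right _).eq
  have hDH : of hm hn hq β σ .d ^ (n - 1) * of hm hn hq β σ .h ^ (m - 1) =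
      of hm hn hq β σ .h ^ (m - 1) * of hm hn hq β σ .d ^ (n - 1) :=
    ((show Commute _ _ from R.d_h).pow_pow _ _).eq
  have hcd := R.c_d
  have hcx := R.c_x
  have hdx := R.d_x
  have hxh := R.x_h
  have hxp := R.x_pow
  refine ⟨?_, ?_, ?_, ?_, ?_, ?_, ?_, ?_, ?_, ?_⟩ <;>
    simp only [antipodeGen, ← op_pow, ← op_mul, ← op_smul, ← op_one, ← op_zero, op_inj,
      pow_two] <;>
    clear R <;>
    generalize hc' : of hm hn hq β σ .c = c at * <;>
    generalize hD' : of hm hn hq β σ .d ^ (n - 1) = D at * <;>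
    generalize hH' : of hm hn hq β σ .h ^ (m - 1) = H at * <;>
    generalize hd' : of hm hn hq β σ .d = d at * <;>
    generalize hh' : of hm hn hq β σ .h = h at * <;>
    generalize hx' : of hm hn hq β σ .x = x at * <;>
    have hHx : H * x = q • (x * H) := by
      calc H * x = H * (x * h) * H := by rw [mul_assoc, mul_assoc, hhH, mul_one]
        _ = q • ((H * h) * x * H) := by
          rw [hxh, mul_smul_comm, smul_mul_assoc]
          simp only [mul_assoc]
        _ = q • (x * H) := by rw [hHh, one_mul]
  · exact hcc
  · exact hDn
  · exact hHm
  · obtain ⟨s, hs⟩ := mul_pow_of_qComm q x H hHx m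
    rw [neg_pow, hs, hxp, zero_mul, smul_zero, mul_zero]
  · exact hcH.symm
  · exact hDH.symm
  · have : D ^ (n - 1) = d := by
      calc D ^ (n - 1) = D ^ (n - 1) * (D * d) := by rw [hDd, mul_one]
        _ = D ^ n * d := by rw [← mul_assoc, ← pow_succ, hn1]
        _ = d := by rw [hDn, one_mul]
    rw [this, hcd]
  · have h1 : β • (c * x) = x * c := by
      calc β • (c * x) = c * (β • (x * c)) * c := by
            rw [mul_smul_comm, smul_mul_assoc, mul_assoc, mul_assoc, hcc, mul_one]
        _ = (c * c) * x * c := by rw [← hcx]; simp only [mul_assoc]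
        _ = x * c := by rw [hcc, one_mul]
    rw [mul_neg, smul_neg, neg_mul, ← mul_assoc, ← smul_mul_assoc, h1, mul_assoc, mul_assoc, hcH]
  · have h1 : σ • (D * x) = x * D := by
      calc σ • (D * x) = D * (σ • (x * d)) * D := by
            rw [mul_smul_comm, smul_mul_assoc, mul_assoc, mul_assoc, hdD, mul_one]
        _ = (D * d) * x * D := by rw [← hdx]; simp only [mul_assoc]
        _ = x * D := by rw [hDd, one_mul]
    rw [mul_neg, smul_neg, neg_mul, ← mul_assoc, ← smul_mul_assoc, h1, mul_assoc, mul_assoc, hDH]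
  · rw [mul_neg, neg_mul, smul_neg, ← mul_assoc, hHx, smul_mul_assoc]

/-- The bialgebra structure: `Δ` and `ε` are the algebra maps with the given values on
generators. -/
instance instBialgebra : Bialgebra K (TaftDihedral hm hn hq β σ) :=
  Bialgebra.ofAlgHom
    (lift hm hn hq (comulGen hm hn hq β σ) (respects_comulGen hm hn hq β σ))
    (lift hm hn hq (counitGen K) (respects_counitGen n q β σ hm))
    (algHom_ext fun g => by
      cases g <;> simp [comulGen, TensorProduct.tmul_add, TensorProduct.add_tmul,
        Algebra.TensorProduct.one_def, add_assoc])
    (algHom_ext fun g => by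
      cases g <;> simp [comulGen, counitGen])
    (algHom_ext fun g => by
      cases g <;> simp [comulGen, counitGen])

theorem comul_of (g : Gen) :
    Coalgebra.comul (R := K) (of hm hn hq β σ g) = comulGen hm hn hq β σ g :=
  lift_of hm hn hq _ (respects_comulGen hm hn hq β σ) g

theorem counit_of (g : Gen) :
    Coalgebra.counit (R := K) (of hm hn hq β σ g) = counitGen K g :=
  lift_of hm hn hq _ (respects_counitGen n q β σ hm) g

/-- The antipode: the algebra anti-homomorphism with the given values on generators. -/
def antipodeMap : TaftDihedral hm hn hq β σ →ₗ[K] TaftDihedral hm hn hq β σ :=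
  (MulOpposite.opLinearEquiv K).symm.toLinearMap ∘ₗ
    (lift hm hn hq _ (respects_antipodeGen hm hn hq β σ)).toLinearMap

theorem antipodeMap_of (g : Gen) :
    antipodeMap hm hn hq β σ (of hm hn hq β σ g) = antipodeGen hm hn hq β σ g := by
  simp [antipodeMap]

theorem antipodeMap_algebraMap (r : K) :
    antipodeMap hm hn hq β σ (algebraMap K _ r) = algebraMap K _ r := by
  simp [antipodeMap]

theorem antipodeMap_mul (a b : TaftDihedral hm hn hq β σ) :
    antipodeMap hm hn hq β σ (a * b) =
      antipodeMap hm hn hq β σ b * antipodeMap hm hn hq β σ a := by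
  simp [antipodeMap]

theorem left_convolution_mul {K A : Type*} [CommRing K] [Ring A] [Algebra K A] (S : A →ₗ[K] A)
    (hS : ∀ a b, S (a * b) = S b * S a) (u v : A ⊗[K] A) (r : K)
    (hu : LinearMap.mul' K A (S.rTensor A u) = algebraMap K A r) :
    LinearMap.mul' K A (S.rTensor A (u * v)) = r • LinearMap.mul' K A (S.rTensor A v) := by
  induction v using TensorProduct.induction_on with
  | zero => simp
  | add v w hv hw => rw [mul_add, map_add, map_add, hv, hw, map_add, map_add, smul_add]
  | tmul b₁ b₂ =>
    have : ∀ u : A ⊗[K] A, LinearMap.mul' K A (S.rTensor A (u * b₁ ⊗ₜ b₂)) =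
        S b₁ * LinearMap.mul' K A (S.rTensor A u) * b₂ := by
      intro u
      induction u using TensorProduct.induction_on with
      | zero => simp
      | add v w hv hw => rw [add_mul, map_add, map_add, hv, hw, map_add, map_add, mul_add, add_mul]
      | tmul a₁ a₂ => simp [hS, mul_assoc]
    rw [this, hu, Algebra.algebraMap_eq_smul_one]
    simp

theorem right_convolution_mul {K A : Type*} [CommRing K] [Ring A] [Algebra K A] (S : A →ₗ[K] A)
    (hS : ∀ a b, S (a * b) = S b * S a) (u v : A ⊗[K] A) (r : K)
    (hv : LinearMap.mul' K A (S.lTensor A v) = algebraMap K A r) :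
    LinearMap.mul' K A (S.lTensor A (u * v)) = r • LinearMap.mul' K A (S.lTensor A u) := by
  induction u using TensorProduct.induction_on with
  | zero => simp
  | add u w hu hw => rw [add_mul, map_add, map_add, hu, hw, map_add, map_add, smul_add]
  | tmul a₁ a₂ =>
    have : ∀ v : A ⊗[K] A, LinearMap.mul' K A (S.lTensor A (a₁ ⊗ₜ a₂ * v)) =
        a₁ * LinearMap.mul' K A (S.lTensor A v) * S a₂ := by
      intro v
      induction v using TensorProduct.induction_on with
      | zero => simp
      | add v w hv hw => rw [mul_add, map_add, map_add, hv, hw, map_add, map_add, mul_add, add_mul]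
      | tmul b₁ b₂ => simp [hS, mul_assoc]
    rw [this, hv, Algebra.algebraMap_eq_smul_one]
    simp

theorem antipode_left (a : TaftDihedral hm hn hq β σ) :
    LinearMap.mul' K _ ((antipodeMap hm hn hq β σ).rTensor _ (Coalgebra.comul (R := K) a)) =
      algebraMap K _ (Coalgebra.counit (R := K) a) := by
  have R := respects_of hm hn hq β σ
  induction a using induction with
  | algebraMap r => simp [Algebra.TensorProduct.algebraMap_apply, antipodeMap_algebraMap]
  | of g =>
    have hm1 : m - 1 + 1 = m := by omega
    have hn1 : n - 1 + 1 = n := by omega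
    have e1 : antipodeMap hm hn hq β σ 1 = 1 := by
      simpa using antipodeMap_algebraMap hm hn hq β σ 1
    rw [comul_of, counit_of]
    cases g <;> simp [comulGen, counitGen, antipodeMap_of, antipodeGen, e1]
    · rw [← pow_two, R.c_pow]
    · rw [← pow_succ, hn1, R.d_pow]
    · rw [← pow_succ, hm1, R.h_pow]
    · rw [mul_assoc, ← pow_succ, hm1, R.h_pow, mul_one, neg_add_cancel]
  | add a b ha hb => simp only [map_add, ha, hb]
  | mul a b ha hb =>
    rw [Bialgebra.comul_mul, left_convolution_mul _ (antipodeMap_mul hm hn hq β σ) _ _ _ ha, hb,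
      Bialgebra.counit_mul, map_mul, Algebra.smul_def]

theorem antipode_right (a : TaftDihedral hm hn hq β σ) :
    LinearMap.mul' K _ ((antipodeMap hm hn hq β σ).lTensor _ (Coalgebra.comul (R := K) a)) =
      algebraMap K _ (Coalgebra.counit (R := K) a) := by
  have R := respects_of hm hn hq β σ
  have e1 : antipodeMap hm hn hq β σ 1 = 1 := by
    simpa using antipodeMap_algebraMap hm hn hq β σ 1
  induction a using induction with
  | algebraMap r => simp [Algebra.TensorProduct.algebraMap_apply, e1]
  | of g =>
    have hm1 : m - 1 + 1 = m := by omega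
    have hn1 : n - 1 + 1 = n := by omega
    rw [comul_of, counit_of]
    cases g <;> simp [comulGen, counitGen, antipodeMap_of, antipodeGen]
    · rw [← pow_two, R.c_pow]
    · rw [← pow_succ', hn1, R.d_pow]
    · rw [← pow_succ', hm1, R.h_pow]
  | add a b ha hb => simp only [map_add, ha, hb]
  | mul a b ha hb =>
    rw [Bialgebra.comul_mul, right_convolution_mul _ (antipodeMap_mul hm hn hq β σ) _ _ _ hb, ha,
      Bialgebra.counit_mul, map_mul, Algebra.smul_def, (Algebra.commutes _ _)]

instance instHopfAlgebra : HopfAlgebra K (TaftDihedral hm hn hq β σ) where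
  antipode := antipodeMap hm hn hq β σ
  mul_antipode_rTensor_comul := LinearMap.ext (antipode_left hm hn hq β σ)
  mul_antipode_lTensor_comul := LinearMap.ext (antipode_right hm hn hq β σ)

theorem antipode_of (g : Gen) :
    HopfAlgebra.antipode K (of hm hn hq β σ g) = antipodeGen hm hn hq β σ g :=
  antipodeMap_of hm hn hq β σ g

end

end TaftDihedral

namespace TaftDihedral

/-! An isomorphism is controlled by two coalgebra invariants: the group-like elements and the
skew-primitive elements of degree one in `x`. The algebra is graded by the degree in `x`, compatibly
with the comultiplication, and this forces group-likes to be products of `c`, `d`, `h`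
(`mem_groupPart_of_isGroupLikeElem`).

Given an isomorphism, the image of `x` is skew-primitive with nonzero degree one part. That part is
a multiple of `x`, and the image of `h` must be `h` (`equiv_h`). Modulo `h` the images of `c` and
`d` generate the dihedral group, so they are a reflection and a generating rotation, each times a
power of `h` (`exists_equiv_c_d`). The relations among `c` and `d`, read through the character
`hCharacter`, give the divisibilities. Comparing the scalars by which the images of `c` and `d`
commute with `x` gives the two equations.

Conversely, the parameters define a map fixing `h` and `x`, whose inverse has the same shape with
explicit parameters (`nonempty_equiv_of_parameters`).

No basis of the algebra is needed: a spanning set suffices, together with the independence of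
group-likes and a small representation showing `x ≠ 0`. -/

theorem mul_qComm {K A : Type*} [CommRing K] [Ring A] [Algebra K A] {a b y : A} {r s : K}
    (ha : a * y = r • (y * a)) (hb : b * y = s • (y * b)) :
    a * b * y = (r * s) • (y * (a * b)) := by
  rw [mul_assoc, hb, mul_smul_comm, ← mul_assoc, ha, smul_mul_assoc, smul_smul, mul_comm s,
    mul_assoc]

theorem pow_qComm {K A : Type*} [CommRing K] [Ring A] [Algebra K A] {a y : A} {r : K}
    (ha : a * y = r • (y * a)) (i : ℕ) : a ^ i * y = r ^ i • (y * a ^ i) := by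
  induction i with
  | zero => simp
  | succ i ih => rw [pow_succ, pow_succ, mul_qComm ih ha]

/-! ### Group-like generators and a spanning set. -/

noncomputable section Structure

variable {K : Type*} [Field K] {m n : ℕ} {q : K} (hm : 2 ≤ m) (hn : 3 ≤ n)
    (hq : IsPrimitiveRoot q m) (β σ : K)

local notation "T" => TaftDihedral hm hn hq β σ
local notation "gen" => of hm hn hq β σ

/-- The submonoid generated by the group-like generators. -/
def groupPart : Submonoid T :=
  Submonoid.closure {gen .c, gen .d, gen .h}

variable {hm hn hq β σ}

theorem c_mem_groupPart : gen .c ∈ groupPart hm hn hq β σ :=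
  Submonoid.subset_closure (by simp)

theorem d_mem_groupPart : gen .d ∈ groupPart hm hn hq β σ :=
  Submonoid.subset_closure (by simp)

theorem h_mem_groupPart : gen .h ∈ groupPart hm hn hq β σ :=
  Submonoid.subset_closure (by simp)

theorem groupPart_induction {P : T → Prop} (one : P 1) (c : P (gen .c)) (d : P (gen .d))
    (h : P (gen .h)) (mul : ∀ a b, P a → P b → P (a * b)) {u : T}
    (hu : u ∈ groupPart hm hn hq β σ) : P u := by
  induction hu using Submonoid.closure_induction with
  | mem a ha =>
    rcases ha with rfl | rfl | rfl
    exacts [c, d, h]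
  | one => exact one
  | mul a b _ _ ha hb => exact mul a b ha hb

theorem isGroupLikeElem_of_mem {u : T} (hu : u ∈ groupPart hm hn hq β σ) :
    IsGroupLikeElem K u := by
  refine groupPart_induction (P := fun u => IsGroupLikeElem K u) .one ?_ ?_ ?_
    (fun _ _ => .mul) hu <;>
  exact ⟨counit_of hm hn hq β σ _, comul_of hm hn hq β σ _⟩

theorem h_mul_x : gen .h * gen .x = q⁻¹ • (gen .x * gen .h) := by
  rw [(respects_of hm hn hq β σ).x_h, smul_smul, inv_mul_cancel₀ (hq.ne_zero (by omega)), one_smul]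

theorem exists_mul_x {u : T} (hu : u ∈ groupPart hm hn hq β σ) :
    ∃ r : K, u * gen .x = r • (gen .x * u) := by
  have R := respects_of hm hn hq β σ
  refine groupPart_induction (P := fun u => ∃ r : K, u * gen .x = r • (gen .x * u)) ⟨1, by simp⟩
    ⟨β, R.c_x⟩ ⟨σ, R.d_x⟩ ⟨q⁻¹, h_mul_x⟩ ?_ hu
  rintro a b ⟨r, hr⟩ ⟨s, hs⟩
  exact ⟨r * s, mul_qComm hr hs⟩

/-- Products of group-like generators commute with `x` up to a scalar, so the span of these
monomials is closed under multiplication and contains the generators. Independence is neither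
claimed nor needed. -/
theorem span_x_pow_mul :
    Submodule.span K {a : T | ∃ k, ∃ u ∈ groupPart hm hn hq β σ, a = gen .x ^ k * u} = ⊤ := by
  set S := {a : T | ∃ k, ∃ u ∈ groupPart hm hn hq β σ, a = gen .x ^ k * u}
  have one : (1 : T) ∈ Submodule.span K S :=
    Submodule.subset_span ⟨0, 1, one_mem _, by simp⟩
  have mul : Submodule.span K S * Submodule.span K S ≤ Submodule.span K S := by
    rw [Submodule.span_mul_span, Submodule.span_le]
    rintro _ ⟨_, ⟨k, u, hu, rfl⟩, _, ⟨l, v, hv, rfl⟩, rfl⟩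
    obtain ⟨r, hr⟩ := exists_mul_x hu
    have : gen .x ^ k * u * (gen .x ^ l * v) = r ^ l • (gen .x ^ (k + l) * (u * v)) := by
      rw [mul_assoc, ← mul_assoc u, mul_pow_qComm r _ _ hr, smul_mul_assoc, mul_smul_comm, pow_add]
      simp only [mul_assoc]
    simp only [SetLike.mem_coe, this]
    exact Submodule.smul_mem _ _ (Submodule.subset_span ⟨_, _, mul_mem hu hv, rfl⟩)
  rw [eq_top_iff]
  rintro a -
  induction a using induction with
  | algebraMap r =>
    rw [Algebra.algebraMap_eq_smul_one]
    exact Submodule.smul_mem _ _ one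
  | of g =>
    apply Submodule.subset_span
    cases g
    · exact ⟨0, _, c_mem_groupPart, by simp⟩
    · exact ⟨0, _, d_mem_groupPart, by simp⟩
    · exact ⟨0, _, h_mem_groupPart, by simp⟩
    · exact ⟨1, 1, one_mem _, by simp⟩
  | mul a b ha hb => exact mul (Submodule.mul_mem_mul ha hb)
  | add a b ha hb => exact add_mem ha hb

theorem linearMap_ext {M : Type*} [AddCommMonoid M] [Module K M] {f g : T →ₗ[K] M}
    (h : ∀ k, ∀ u ∈ groupPart hm hn hq β σ, f (gen .x ^ k * u) = g (gen .x ^ k * u)) : f = g :=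
  LinearMap.ext_on span_x_pow_mul (by rintro _ ⟨k, u, hu, rfl⟩; exact h k u hu)

/-! ### The grading by degree in `x`, group-likes and skew-primitives. -/

section Grading

open Polynomial

variable (hm hn hq β σ)

/-- The grading by the degree in `x`, as a coaction of the polynomial ring. -/
def grading : T →ₐ[K] T[X] :=
  lift hm hn hq (fun
      | .c => C (gen .c)
      | .d => C (gen .d)
      | .h => C (gen .h)
      | .x => X * C (gen .x))
    (by
      have R := respects_of hm hn hq β σ
      have hX : ∀ a : T, C a * X = X * C a := fun a => (X_mul_C a).symm
      constructor <;> simp only [← C_mul, ← C_pow, R.c_pow, R.d_pow, R.h_pow, R.c_h, R.d_h, R.c_d,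
        C_1]
      · rw [(commute_X (C (gen .x))).mul_pow, ← C_pow, R.x_pow, C_0, mul_zero]
      · rw [← mul_assoc, hX, mul_assoc, mul_assoc, ← C_mul, ← C_mul, R.c_x, ← smul_C,
          mul_smul_comm]
      · rw [← mul_assoc, hX, mul_assoc, mul_assoc, ← C_mul, ← C_mul, R.d_x, ← smul_C,
          mul_smul_comm]
      · rw [← mul_assoc, hX, mul_assoc, mul_assoc, ← C_mul, ← C_mul, R.x_h, ← smul_C,
          mul_smul_comm])

/-- The homogeneous component of degree `i` in `x`. -/
def component (i : ℕ) : T →ₗ[K] T :=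
  (lcoeff T i).restrictScalars K ∘ₗ (grading hm hn hq β σ).toLinearMap

local notation "comp" => component hm hn hq β σ

theorem component_apply (i : ℕ) (a : T) : comp i a = (grading hm hn hq β σ a).coeff i := rfl

variable {hm hn hq β σ}

theorem grading_of_mem {u : T} (hu : u ∈ groupPart hm hn hq β σ) :
    grading hm hn hq β σ u = C u := by
  refine groupPart_induction (P := fun u => grading hm hn hq β σ u = C u) (by simp) ?_ ?_ ?_ ?_ hu
  iterate 3 exact lift_of hm hn hq _ _ _
  intro a b ha hb
  rw [map_mul, ha, hb, C_mul]

theorem grading_x : grading hm hn hq β σ (gen .x) = X * C (gen .x) :=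
  lift_of hm hn hq _ _ _

theorem component_x_pow_mul (i k : ℕ) {u : T} (hu : u ∈ groupPart hm hn hq β σ) :
    comp i (gen .x ^ k * u) = if i = k then gen .x ^ k * u else 0 := by
  rw [component_apply, map_mul, map_pow, grading_x, grading_of_mem hu,
    (commute_X (C (gen .x))).mul_pow, mul_assoc, ← C_pow, ← C_mul, coeff_X_pow_mul', coeff_C]
  grind

theorem component_of_mem {u : T} (hu : u ∈ groupPart hm hn hq β σ) (i : ℕ) :
    comp i u = if i = 0 then u else 0 := by
  simpa using component_x_pow_mul i 0 hu

theorem component_x (i : ℕ) : comp i (gen .x) = if i = 1 then gen .x else 0 := by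
  simpa using component_x_pow_mul i 1 (one_mem (groupPart hm hn hq β σ))

theorem component_one_mul (a b : T) :
    comp 1 (a * b) = comp 0 a * comp 1 b + comp 1 a * comp 0 b := by
  simp [component_apply, coeff_mul, Finset.Nat.antidiagonal_succ]

/-- Evaluating the coaction at `X = 1` gives back the element. Evaluation over a noncommutative ring
need not be multiplicative, so this is checked on the spanning monomials. -/
theorem sum_component (a : T) {N : ℕ} (hN : (grading hm hn hq β σ a).natDegree < N) :
    ∑ i ∈ Finset.range N, comp i a = a := by
  have key : (Polynomial.leval (1 : T)).restrictScalars K ∘ₗ (grading hm hn hq β σ).toLinearMap =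
      LinearMap.id := by
    refine linearMap_ext fun k u hu => ?_
    rw [LinearMap.comp_apply, AlgHom.toLinearMap_apply, map_mul, map_pow, grading_x,
      grading_of_mem hu, (commute_X (C (gen .x))).mul_pow, mul_assoc, ← C_pow, ← C_mul, X_pow_mul]
    exact (eval_mul_X_pow ..).trans (by rw [eval_C, one_pow, mul_one, LinearMap.id_apply])
  have := LinearMap.congr_fun key a
  rw [LinearMap.comp_apply] at this
  simp only [AlgHom.toLinearMap_apply, LinearMap.restrictScalars_apply, leval_apply,
    eval_eq_sum_range' hN, one_pow, mul_one, LinearMap.id_apply] at this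
  exact this

/-- The two summands of the comultiplication of `x` commute up to `q`, so the `q`-binomial theorem
applies. -/
theorem comul_x_pow_mul (k : ℕ) {u : T} (hu : u ∈ groupPart hm hn hq β σ) :
    Coalgebra.comul (R := K) (gen .x ^ k * u) = ∑ i ∈ Finset.range (k + 1),
      qChoose q k i • ((gen .x ^ i * u) ⊗ₜ[K] (gen .h ^ i * gen .x ^ (k - i) * u)) := by
  have R := respects_of hm hn hq β σ
  rw [Bialgebra.comul_mul, Bialgebra.comul_pow, comul_of, comulGen,
    (isGroupLikeElem_of_mem hu).comul_eq_tmul_self, add_pow_qComm q, Finset.sum_mul]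
  · simp [Algebra.TensorProduct.tmul_pow]
  · simp [R.x_h]

theorem map_component_comul (i j k : ℕ) {u : T} (hu : u ∈ groupPart hm hn hq β σ) :
    TensorProduct.map (comp i) (comp j) (Coalgebra.comul (R := K) (gen .x ^ k * u)) =
      if i + j = k then
        qChoose q k i • ((gen .x ^ i * u) ⊗ₜ[K] (gen .h ^ i * gen .x ^ j * u)) else 0 := by
  -- Moving `h ^ a` to the right of `x ^ b` costs only a scalar and yields a spanning monomial.
  have key : ∀ a b, comp j (gen .h ^ a * gen .x ^ b * u) =
      if j = b then gen .h ^ a * gen .x ^ b * u else 0 := by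
    intro a b
    obtain ⟨r, hr⟩ := exists_mul_x (pow_mem
      (h_mem_groupPart (hm := hm) (hn := hn) (hq := hq) (β := β) (σ := σ)) a)
    rw [mul_pow_qComm r _ _ hr, smul_mul_assoc, mul_assoc, map_smul,
      component_x_pow_mul _ _ (mul_mem (pow_mem h_mem_groupPart a) hu), smul_ite, smul_zero]
  simp only [comul_x_pow_mul k hu, map_sum, map_smul, TensorProduct.map_tmul, key,
    component_x_pow_mul _ _ hu]
  split_ifs with h
  · rw [Finset.sum_eq_single i]
    · simp [← h]
    · intro b _ hb
      simp [hb.symm]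
    · intro hi
      exact absurd (Finset.mem_range.mpr (by omega)) hi
  · refine Finset.sum_eq_zero fun b hb => ?_
    have := Finset.mem_range.mp hb
    by_cases h1 : i = b
    · rw [if_neg (show j ≠ k - b by omega), TensorProduct.tmul_zero, smul_zero]
    · rw [if_neg h1, TensorProduct.zero_tmul, smul_zero]

/-- The comultiplication is graded: bidegree `(i, j)` sees only the part of degree `i + j`. -/
theorem map_component_comul_component (i j : ℕ) (a : T) :
    TensorProduct.map (comp i) (comp j) (Coalgebra.comul (R := K) (comp (i + j) a)) =
      TensorProduct.map (comp i) (comp j) (Coalgebra.comul (R := K) a) := by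
  have key : TensorProduct.map (comp i) (comp j) ∘ₗ Coalgebra.comul (R := K) ∘ₗ comp (i + j) =
      TensorProduct.map (comp i) (comp j) ∘ₗ Coalgebra.comul (R := K) := by
    refine linearMap_ext fun k u hu => ?_
    simp only [LinearMap.comp_apply, component_x_pow_mul _ _ hu]
    split_ifs with h
    · rfl
    · rw [map_component_comul _ _ _ hu, if_neg h, map_zero, map_zero]
  exact LinearMap.congr_fun key a

theorem component_zero_mem_span (a : T) :
    comp 0 a ∈ Submodule.span K (groupPart hm hn hq β σ : Set T) := by
  have : (⊤ : Submodule K T) ≤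
      (Submodule.span K (groupPart hm hn hq β σ : Set T)).comap (comp 0) := by
    rw [← span_x_pow_mul, Submodule.span_le]
    rintro _ ⟨k, u, hu, rfl⟩
    simp only [Submodule.comap_coe, Set.mem_preimage, component_x_pow_mul _ _ hu]
    split_ifs with h
    · subst h
      simpa using Submodule.subset_span hu
    · exact zero_mem _
  exact this trivial

/-- If the top degree `L` were positive, `a ⊗ a` would have a nonzero part in bidegree `(L, L)`,
whereas that part comes from the component of `a` in degree `2L > L`, which is zero. -/
theorem natDegree_grading_of_isGroupLikeElem {a : T} (ha : IsGroupLikeElem K a) :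
    (grading hm hn hq β σ a).natDegree = 0 := by
  set L := (grading hm hn hq β σ a).natDegree with hL
  by_contra h0
  have h1 : comp (L + L) a = 0 := 
    coeff_eq_zero_of_natDegree_lt (show L < L + L by omega)
  have h2 := map_component_comul_component L L a
  have h3 : comp L a ≠ 0 := by
    rw [component_apply, hL, coeff_natDegree, Ne, leadingCoeff_eq_zero]
    intro h
    rw [h, natDegree_zero] at hL
    exact h0 hL
  obtain ⟨f, hf⟩ : ∃ f : Module.Dual K T, f (comp L a) ≠ 0 := by
    by_contra! h
    exact h3 ((Module.forall_dual_apply_eq_zero_iff K _).1 h)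
  rw [h1, map_zero, map_zero, ha.comul_eq_tmul_self, TensorProduct.map_tmul] at h2
  have h4 := congrArg (fun z => TensorProduct.lid K T (f.rTensor T z)) h2
  simp only [map_zero, LinearMap.rTensor_tmul, TensorProduct.lid_tmul] at h4
  exact smul_ne_zero hf h3 h4.symm

/-- Group-like elements are the products of group-like generators. -/
theorem mem_groupPart_of_isGroupLikeElem {a : T} (ha : IsGroupLikeElem K a) :
    a ∈ groupPart hm hn hq β σ := by
  have h0 : comp 0 a = a := by
    simpa using sum_component a (N := 1) (by rw [natDegree_grading_of_isGroupLikeElem ha]; omega)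
  have h1 := component_zero_mem_span a
  rw [h0] at h1
  -- Distinct group-likes are linearly independent, so a group-like in the span of `groupPart`
  -- already belongs to it.
  have hli : LinearIndepOn K id (insert a (groupPart hm hn hq β σ : Set T)) :=
    (linearIndepOn_isGroupLikeElem (R := K) (A := T)).mono
      (Set.insert_subset ha fun _ => isGroupLikeElem_of_mem)
  by_contra hna
  refine hli.notMem_span_of_insert hna ?_
  simpa using h1

/-- A coordinate functional for a basis extending the independent set of group-likes. It isolates
one group-like in a tensor leg. -/
theorem exists_dual_groupPart {u : T} (hu : u ∈ groupPart hm hn hq β σ) :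
    ∃ f : Module.Dual K T, f u = 1 ∧ ∀ v ∈ groupPart hm hn hq β σ, v ≠ u → f v = 0 := by
  have hli := linearIndepOn_isGroupLikeElem (R := K) (A := T)
  let b := Module.Basis.extend hli
  have hsub := hli.subset_extend (Set.subset_univ _)
  have hb : ∀ v, (hv : v ∈ groupPart hm hn hq β σ) →
      b.repr v = Finsupp.single ⟨v, hsub (isGroupLikeElem_of_mem hv)⟩ 1 := by
    intro v hv
    rw [← b.repr_self, Module.Basis.extend_apply_self]
  refine ⟨b.coord ⟨u, hsub (isGroupLikeElem_of_mem hu)⟩, ?_, fun v hv hvu => ?_⟩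
  · simp [hb u hu]
  · simp [hb v hv, hvu]

/-- The degree one part of a skew-primitive element is a multiple of `x`. -/
theorem exists_component_one_eq_smul {y g : T} (hg : g ∈ groupPart hm hn hq β σ)
    (hy : Coalgebra.comul (R := K) y = y ⊗ₜ g + 1 ⊗ₜ y) : ∃ a : K, comp 1 y = a • gen .x := by
  obtain ⟨f, hf1, hf⟩ := exists_dual_groupPart (one_mem (groupPart hm hn hq β σ))
  -- `E` takes bidegree `(0, 1)` of the comultiplication and contracts the left leg with the
  -- functional dual to `1`. A monomial `x * u` has `u ⊗ x * u` there, so only `u = 1` survives; on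
  -- `y` only the term `1 ⊗ y` contributes.
  let E : T →ₗ[K] T := (TensorProduct.lid K T).toLinearMap ∘ₗ f.rTensor T ∘ₗ
    TensorProduct.map (comp 0) (comp 1) ∘ₗ Coalgebra.comul
  have hE : ∀ a, E a ∈ Submodule.span K {gen .x} := by
    have : (⊤ : Submodule K T) ≤ (Submodule.span K {gen .x}).comap E := by
      rw [← span_x_pow_mul, Submodule.span_le]
      rintro _ ⟨k, u, hu, rfl⟩
      simp only [Submodule.comap_coe, Set.mem_preimage, E, LinearMap.comp_apply,
        map_component_comul _ _ _ hu, SetLike.mem_coe]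
      split_ifs with h
      · by_cases h1 : u = 1
        · subst h1
          simp only [pow_zero, mul_one, one_mul, map_smul, LinearMap.rTensor_tmul,
            LinearEquiv.coe_coe, TensorProduct.lid_tmul, pow_one]
          exact Submodule.smul_mem _ _ (Submodule.smul_mem _ _ (Submodule.mem_span_singleton_self _))
        · simp [hf u hu h1]
      · simp
    exact fun a => this trivial
  have h1 : E y = comp 1 y := by
    simp [E, hy, component_of_mem hg, component_of_mem (one_mem (groupPart hm hn hq β σ)), hf1]
  obtain ⟨a, ha⟩ := Submodule.mem_span_singleton.mp (hE y)
  exact ⟨a, by rw [← h1, ha]⟩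

/-- In bidegree `(1, 0)` the degree one part `a • x` of `y` gives `a • x ⊗ h`, while the
skew-primitive formula gives `a • x ⊗ g`. A functional dual to `g` distinguishes them unless `g =
h`. -/
theorem eq_h_of_component_one_ne_zero {y g : T} (hg : g ∈ groupPart hm hn hq β σ)
    (hy : Coalgebra.comul (R := K) y = y ⊗ₜ g + 1 ⊗ₜ y) (hy1 : comp 1 y ≠ 0) : g = gen .h := by
  obtain ⟨a, ha⟩ := exists_component_one_eq_smul hg hy
  obtain ⟨f, hf1, hf⟩ := exists_dual_groupPart hg
  by_contra hgh
  have h0 := map_component_comul_component 1 0 y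
  have h1 := map_component_comul 1 0 1 (one_mem (groupPart hm hn hq β σ))
  rw [add_zero, ha, hy] at h0
  simp only [pow_one, mul_one, pow_zero] at h1
  rw [map_smul, map_smul, h1] at h0
  have h2 := congrArg (fun z => TensorProduct.rid K T (f.lTensor T z)) h0
  simp [component_of_mem hg, component_of_mem (one_mem (groupPart hm hn hq β σ)), hf1,
    hf _ (h_mem_groupPart) (Ne.symm hgh)] at h2
  exact hy1 h2.symm

end Grading

/-! ### Normal form of the group-like elements. -/

theorem exists_normal_form {u : T} (hu : u ∈ groupPart hm hn hq β σ) :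
    ∃ i < n, ∃ j < 2, ∃ k < m, u = gen .d ^ i * gen .c ^ j * gen .h ^ k := by
  have R := respects_of hm hn hq β σ
  have hcd : ∀ j i, ∃ i', gen .c ^ j * gen .d ^ i = gen .d ^ i' * gen .c ^ j := by
    intro j
    induction j with
    | zero => exact fun i => ⟨i, by simp⟩
    | succ j ih =>
      intro i
      have h1 : gen .c * gen .d ^ i = (gen .d ^ (n - 1)) ^ i * gen .c :=
        (show SemiconjBy (gen .c) (gen .d) (gen .d ^ (n - 1)) from R.c_d).pow_right i
      obtain ⟨i', hi'⟩ := ih ((n - 1) * i)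
      exact ⟨i', by rw [pow_succ, mul_assoc, h1, ← pow_mul, ← mul_assoc, hi', mul_assoc]⟩
  suffices ∃ i j k : ℕ, u = gen .d ^ i * gen .c ^ j * gen .h ^ k by
    obtain ⟨i, j, k, rfl⟩ := this
    exact ⟨i % n, Nat.mod_lt _ (by omega), j % 2, Nat.mod_lt _ (by omega), k % m,
      Nat.mod_lt _ (by omega), by
        rw [← pow_eq_pow_mod i R.d_pow, ← pow_eq_pow_mod j R.c_pow, ← pow_eq_pow_mod k R.h_pow]⟩
  refine groupPart_induction (P := fun u => ∃ i j k : ℕ, u = gen .d ^ i * gen .c ^ j * gen .h ^ k)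
    ⟨0, 0, 0, by simp⟩ ⟨0, 1, 0, by simp⟩ ⟨1, 0, 0, by simp⟩ ⟨0, 0, 1, by simp⟩ ?_ hu
  rintro _ _ ⟨i, j, k, rfl⟩ ⟨i₂, j₂, k₂, rfl⟩
  obtain ⟨i', hi'⟩ := hcd j i₂
  have hhd : gen .h ^ k * gen .d ^ i₂ = gen .d ^ i₂ * gen .h ^ k :=
    ((show Commute (gen .d) (gen .h) from R.d_h).symm.pow_pow k i₂).eq
  have hhc : gen .h ^ k * gen .c ^ j₂ = gen .c ^ j₂ * gen .h ^ k :=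
    ((show Commute (gen .c) (gen .h) from R.c_h).symm.pow_pow k j₂).eq
  refine ⟨i + i', j + j₂, k + k₂, ?_⟩
  calc gen .d ^ i * gen .c ^ j * gen .h ^ k * (gen .d ^ i₂ * gen .c ^ j₂ * gen .h ^ k₂)
      = gen .d ^ i * gen .c ^ j * (gen .h ^ k * gen .d ^ i₂) * gen .c ^ j₂ * gen .h ^ k₂ := by
        simp only [mul_assoc]
    _ = gen .d ^ i * (gen .c ^ j * gen .d ^ i₂) * (gen .h ^ k * gen .c ^ j₂) * gen .h ^ k₂ := by
        rw [hhd]; simp only [mul_assoc]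
    _ = gen .d ^ (i + i') * gen .c ^ (j + j₂) * gen .h ^ (k + k₂) := by
        rw [hhc, hi']; simp only [pow_add, mul_assoc]

/-! ### Representations that detect the exponents and the nonvanishing of `x`. -/

section Representations

variable (hm hn hq β σ)

/-- The quotient map onto the group algebra of the dihedral group. -/
def toDihedral : T →ₐ[K] MonoidAlgebra K (DihedralGroup n) :=
  lift hm hn hq (fun
      | .c => MonoidAlgebra.of K _ (.sr 0)
      | .d => MonoidAlgebra.of K _ (.r 1)
      | .h => 1
      | .x => 0)
    (by
      constructor <;> simp only [← map_pow, ← map_mul, ← map_one (MonoidAlgebra.of K _), mul_zero,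
        zero_mul, smul_zero, one_pow, one_mul, mul_one]
      · rw [pow_two, DihedralGroup.sr_mul_self]
      · rw [DihedralGroup.r_one_pow_n]
      · rw [zero_pow (by omega)]
      · rw [DihedralGroup.r_one_pow, DihedralGroup.sr_mul_r, DihedralGroup.r_mul_sr]
        congr 2
        push_cast [Nat.cast_sub (show 1 ≤ n by omega)]
        simp)

/-- The character sending `h` to `q`, `c` and `d` to `1`, and `x` to `0`. -/
def hCharacter : T →ₐ[K] K :=
  lift hm hn hq (fun
      | .c => 1
      | .d => 1
      | .h => q
      | .x => 0)
    (by constructor <;> simp [hq.pow_eq_one, show m ≠ 0 by omega])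

variable {hm hn hq β σ}

theorem toDihedral_normal_form (i j k : ℕ) :
    toDihedral hm hn hq β σ (gen .d ^ i * gen .c ^ j * gen .h ^ k) =
      MonoidAlgebra.of K _ (.r 1 ^ i * .sr 0 ^ j) := by
  simp only [map_mul, map_pow, toDihedral, lift_of, one_pow, mul_one]

theorem hCharacter_normal_form (i j k : ℕ) :
    hCharacter hm hn hq β σ (gen .d ^ i * gen .c ^ j * gen .h ^ k) = q ^ k := by
  simp only [map_mul, map_pow, hCharacter, lift_of, one_pow, one_mul]

/-- In a two-dimensional representation `x` acts as a matrix unit, and `c`, `d`, `h` as diagonal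
matrices whose second entries are the scalars by which they commute with `x`. Diagonal matrices
commute, so the dihedral relation requires `σ ^ (n - 1) = σ`, which is where `σ ^ 2 = 1` enters. -/
theorem x_ne_zero (hβ : β ^ 2 = 1) (hσ : σ ^ n = 1) (hσ2 : σ ^ 2 = 1) : gen .x ≠ 0 := by
  have hq0 := hq.ne_zero (show m ≠ 0 by omega)
  have hx : (!![0, 0; 1, 0] : Matrix (Fin 2) (Fin 2) K) ^ m = 0 := by
    obtain ⟨k, rfl⟩ := Nat.exists_eq_add_of_le hm
    rw [pow_add, show (!![0, 0; 1, 0] : Matrix (Fin 2) (Fin 2) K) ^ 2 = 0 by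
      ext i j; fin_cases i <;> fin_cases j <;> simp [pow_two], zero_mul]
  have hσ1 : σ ^ (n - 1) = σ := by
    have : σ * σ ^ (n - 1) = σ * σ := by
      rw [← pow_succ', Nat.sub_add_cancel (by omega), hσ, ← hσ2, pow_two]
    exact mul_left_cancel₀ (fun h => by simp [h] at hσ2) this
  let M : Gen → Matrix (Fin 2) (Fin 2) K := fun
    | .c => .diagonal ![1, β]
    | .d => .diagonal ![1, σ]
    | .h => .diagonal ![1, q⁻¹]
    | .x => !![0, 0; 1, 0]
  have hM : Respects m n q β σ M := by
    constructor <;> simp only [M, Matrix.diagonal_pow, Matrix.diagonal_mul_diagonal, hx]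
    all_goals
      ext i j
      fin_cases i <;> fin_cases j <;>
        simp [hβ, hσ, hσ1, hq.pow_eq_one, Matrix.diagonal, Matrix.mul_apply, Matrix.vecHead,
          hq0, mul_comm]
  intro h
  have := congrArg (fun z => lift hm hn hq M hM z 1 0) h
  simp [M] at this

end Representations

end Structure

end TaftDihedral
namespace TaftDihedral

/-! ### Necessity: parameters extracted from an isomorphism. -/

noncomputable section Isomorphisms

variable {K : Type*} [Field K] {m n : ℕ} {q : K} {hm : 2 ≤ m} {hn : 3 ≤ n}
    {hq : IsPrimitiveRoot q m} {β β' σ σ' : K}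

local notation "gen" => of hm hn hq β' σ'

/-- The degree one part of `huy` is the same relation for `a • x`. Since `u` is invertible, `a • (x
* u)` is nonzero and the scalars can be compared. -/
theorem eq_of_qComm_skewPrimitive {u y : TaftDihedral hm hn hq β' σ'} {a b r : K}
    (hu : u ∈ groupPart hm hn hq β' σ') (hy : component hm hn hq β' σ' 1 y = a • gen .x)
    (hy0 : component hm hn hq β' σ' 1 y ≠ 0) (huy : u * y = b • (y * u))
    (hux : u * gen .x = r • (gen .x * u)) : r = b := by
  have h1 := congrArg (component hm hn hq β' σ' 1) huy
  simp only [map_smul, component_one_mul, component_of_mem hu, hy, hux, if_true, one_ne_zero,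
    if_false, zero_mul, mul_zero, add_zero, zero_add, mul_smul_comm, smul_mul_assoc] at h1
  rw [hy] at hy0
  have h2 : a • (gen .x * u) ≠ 0 := by
    rw [← smul_mul_assoc, Ne, (isGroupLikeElem_of_mem hu).isUnit.mul_left_eq_zero]
    exact hy0
  rw [smul_comm] at h1
  exact smul_left_injective K h2 h1

/-- By the Leibniz-type rule `component_one_mul`, elements without degree one part are closed under
products. Images of group-likes are such elements, so if the image of `x` were too, surjectivity
would contradict `x ≠ 0`. -/
theorem component_one_equiv_x_ne_zero
    (φ : TaftDihedral hm hn hq β σ ≃ₐc[K] TaftDihedral hm hn hq β' σ') (hx : gen .x ≠ 0) :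
    component hm hn hq β' σ' 1 (φ (of hm hn hq β σ .x)) ≠ 0 := by
  intro h0
  have key : ∀ a, component hm hn hq β' σ' 1 (φ a) = 0 := by
    intro a
    have hgrp : ∀ u ∈ groupPart hm hn hq β σ, component hm hn hq β' σ' 1 (φ u) = 0 := by
      intro u hu
      have := mem_groupPart_of_isGroupLikeElem ((isGroupLikeElem_of_mem hu).map φ)
      simp [component_of_mem this]
    induction a using induction with
    | algebraMap r =>
      rw [Algebra.algebraMap_eq_smul_one, map_smul, map_smul, hgrp 1 (one_mem _), smul_zero]
    | of g =>
      cases g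
      exacts [hgrp _ (c_mem_groupPart), hgrp _ (d_mem_groupPart),
        hgrp _ (h_mem_groupPart), h0]
    | mul a b ha hb => rw [map_mul, component_one_mul, ha, hb, mul_zero, zero_mul, add_zero]
    | add a b ha hb => rw [map_add, map_add, ha, hb, add_zero]
  have := key (φ.symm (gen .x))
  rw [BialgEquiv.apply_symm_apply, component_x, if_pos rfl] at this
  exact hx this

theorem equiv_h (φ : TaftDihedral hm hn hq β σ ≃ₐc[K] TaftDihedral hm hn hq β' σ')
    (hx : gen .x ≠ 0) : φ (of hm hn hq β σ .h) = gen .h ∧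
      ∃ a : K, component hm hn hq β' σ' 1 (φ (of hm hn hq β σ .x)) = a • gen .x := by
  have hg : φ (of hm hn hq β σ .h) ∈ groupPart hm hn hq β' σ' :=
    mem_groupPart_of_isGroupLikeElem ((isGroupLikeElem_of_mem (h_mem_groupPart)).map φ)
  have hy : Coalgebra.comul (R := K) (φ (of hm hn hq β σ .x)) =
      φ (of hm hn hq β σ .x) ⊗ₜ φ (of hm hn hq β σ .h) + 1 ⊗ₜ φ (of hm hn hq β σ .x) := by
    rw [← CoalgHomClass.map_comp_comul_apply, comul_of, comulGen]
    simp
  exact ⟨eq_h_of_component_one_ne_zero hg hy (component_one_equiv_x_ne_zero φ hx),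
    exists_component_one_eq_smul hg hy⟩

/-- The images of `c` and `d` under an isomorphism. -/
theorem exists_equiv_c_d (φ : TaftDihedral hm hn hq β σ ≃ₐc[K] TaftDihedral hm hn hq β' σ')
    (hx : gen .x ≠ 0) : ∃ f < m, ∃ F < m, ∃ s < n, ∃ t < n, Nat.gcd t n = 1 ∧
      φ (of hm hn hq β σ .c) = gen .d ^ s * gen .c ^ 1 * gen .h ^ f ∧
      φ (of hm hn hq β σ .d) = gen .d ^ t * gen .c ^ 0 * gen .h ^ F := by
  have hgrp : ∀ u ∈ groupPart hm hn hq β σ, φ u ∈ groupPart hm hn hq β' σ' := fun u hu =>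
    mem_groupPart_of_isGroupLikeElem ((isGroupLikeElem_of_mem hu).map φ)
  have hgrp' : ∀ u ∈ groupPart hm hn hq β' σ', φ.symm u ∈ groupPart hm hn hq β σ := fun u hu =>
    mem_groupPart_of_isGroupLikeElem ((isGroupLikeElem_of_mem hu).map φ.symm)
  obtain ⟨s, hs, j₁, hj₁, f, hf, hc⟩ := exists_normal_form (hgrp _ (c_mem_groupPart))
  obtain ⟨t, ht, j₂, hj₂, F, hF, hd⟩ := exists_normal_form (hgrp _ (d_mem_groupPart))
  set γ : DihedralGroup n := .r 1 ^ s * .sr 0 ^ j₁ with hγ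
  set δ : DihedralGroup n := .r 1 ^ t * .sr 0 ^ j₂ with hδ
  have hinj := MonoidAlgebra.of_injective (R := K) (M := DihedralGroup n)
  have hθc : toDihedral hm hn hq β' σ' (φ (of hm hn hq β σ .c)) = MonoidAlgebra.of K _ γ := by
    rw [hc, toDihedral_normal_form]
  have hθd : toDihedral hm hn hq β' σ' (φ (of hm hn hq β σ .d)) = MonoidAlgebra.of K _ δ := by
    rw [hd, toDihedral_normal_form]
  -- Pull `u` back along the isomorphism and write it in normal form. Since `h` is fixed and maps to
  -- `1`, the elements `γ` and `δ` generate the dihedral group.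
  have hgen : ∀ (g : DihedralGroup n), ∀ u ∈ groupPart hm hn hq β' σ',
      toDihedral hm hn hq β' σ' u = MonoidAlgebra.of K _ g → ∃ i, ∃ j < 2, g = δ ^ i * γ ^ j := by
    intro g u hu hg
    obtain ⟨i, -, j, hj, k, -, h⟩ := exists_normal_form (hgrp' u hu)
    refine ⟨i, j, hj, hinj ?_⟩
    have h1 := congrArg (fun z => toDihedral hm hn hq β' σ' (φ z)) h
    rw [BialgEquiv.apply_symm_apply, hg] at h1
    simp only [map_mul, map_pow, (equiv_h φ hx).1] at h1
    rw [h1, hθc, hθd]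
    simp [toDihedral]
  have hsr := hgen (.sr 0) _ (c_mem_groupPart) (lift_of ..)
  have hr := hgen (.r 1) _ (d_mem_groupPart) (lift_of ..)
  -- Otherwise the dihedral group would be abelian, forcing `n ∣ 2`.
  have hnc : ¬ Commute γ δ := by
    intro h
    obtain ⟨i, j, -, e₁⟩ := hsr
    obtain ⟨i', j', -, e₂⟩ := hr
    have h1 : Commute (DihedralGroup.sr (0 : ZMod n)) (.r 1) := by
      rw [e₁, e₂]
      exact (((Commute.refl δ).pow_pow _ _).mul_right (h.symm.pow_pow _ _)).mul_left
        ((h.pow_pow _ _).mul_right ((Commute.refl γ).pow_pow _ _))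
    have h2 := h1.eq
    rw [DihedralGroup.sr_mul_r, DihedralGroup.r_mul_sr, DihedralGroup.sr.injEq] at h2
    have h3 : ((2 : ℕ) : ZMod n) = 0 := by
      push_cast
      linear_combination h2
    have := Nat.le_of_dvd (by omega) ((ZMod.natCast_eq_zero_iff 2 n).mp h3)
    omega
  have hR := respects_of hm hn hq β σ
  -- If `δ` were a reflection, it would be an involution with `δ ^ (n - 1) = δ`, and the dihedral
  -- relation would make it commute with `γ`.
  obtain rfl : j₂ = 0 := by
    by_contra hj
    obtain rfl : j₂ = 1 := by omega
    apply hnc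
    have hδ2 : δ * δ = 1 := by
      rw [hδ, pow_one, DihedralGroup.r_one_pow, DihedralGroup.r_mul_sr, DihedralGroup.sr_mul_self]
    have hδn : δ ^ n = 1 := by
      apply hinj
      rw [map_pow, ← hθd, ← map_pow, ← map_pow, hR.d_pow, map_one, map_one, map_one]
    have hδ1 : δ ^ (n - 1) = δ := by
      rw [← mul_left_inj δ, ← pow_succ, Nat.sub_add_cancel (by omega), hδn, hδ2]
    have := congrArg (fun z => toDihedral hm hn hq β' σ' (φ z)) hR.c_d
    simp only [map_mul, map_pow, hθc, hθd] at this
    rw [← map_pow, ← map_mul, ← map_mul, hδ1] at this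
    exact hinj this
  -- Two rotations would commute.
  obtain rfl : j₁ = 1 := by
    by_contra hj
    obtain rfl : j₁ = 0 := by omega
    apply hnc
    rw [hγ, hδ, pow_zero, mul_one, mul_one]
    exact (Commute.refl _).pow_pow _ _
  refine ⟨f, hf, F, hF, s, hs, t, ht, ?_, hc, hd⟩
  -- The rotation `r 1` must be a power of `δ = r t`, so `t` is a unit modulo `n`.
  obtain ⟨i, j, hj, e⟩ := hr
  rw [pow_zero, mul_one, DihedralGroup.r_one_pow] at hδ
  rw [pow_one, DihedralGroup.r_one_pow, DihedralGroup.r_mul_sr] at hγ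
  rw [hδ, hγ, DihedralGroup.r_pow] at e
  obtain rfl | rfl : j = 0 ∨ j = 1 := by omega
  · rw [pow_zero, mul_one, DihedralGroup.r.injEq] at e
    exact (ZMod.isUnit_iff_coprime t n).mp (IsUnit.of_mul_eq_one _ e.symm)
  · rw [pow_one, DihedralGroup.r_mul_sr] at e
    cases e

theorem exists_parameters_of_equiv
    (φ : TaftDihedral hm hn hq β σ ≃ₐc[K] TaftDihedral hm hn hq β' σ')
    (hβ : β ^ 2 = 1) (hβ' : β' ^ 2 = 1) (hσ : σ ^ 2 = 1) (hσ' : σ' ^ 2 = 1) (hσn' : σ' ^ n = 1) :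
    ∃ f < m, ∃ F < m, ∃ s < n, ∃ t < n, Nat.gcd t n = 1 ∧
        m ∣ 2 * f ∧ m ∣ n * F ∧ m ∣ 2 * F ∧
        q ^ f = β * β' * σ' ^ s ∧ q ^ F = σ * σ' ^ t := by
  have hx : gen .x ≠ 0 := x_ne_zero hβ' hσn' hσ'
  obtain ⟨f, hf, F, hF, s, hs, t, ht, hgcd, hc, hd⟩ := exists_equiv_c_d φ hx
  obtain ⟨-, a, ha⟩ := equiv_h φ hx
  have hy0 := component_one_equiv_x_ne_zero φ hx
  have R := respects_of hm hn hq β σ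
  have R' := respects_of hm hn hq β' σ'
  have hq0 : q ≠ 0 := hq.ne_zero (by omega)
  have hχc : hCharacter hm hn hq β' σ' (φ (of hm hn hq β σ .c)) = q ^ f := by
    rw [hc, hCharacter_normal_form]
  have hχd : hCharacter hm hn hq β' σ' (φ (of hm hn hq β σ .d)) = q ^ F := by
    rw [hd, hCharacter_normal_form]
  have e₁ : q ^ (2 * f) = 1 := by
    rw [mul_comm, pow_mul, ← hχc, ← map_pow, ← map_pow, R.c_pow, map_one, map_one]
  have e₂ : q ^ (n * F) = 1 := by
    rw [mul_comm, pow_mul, ← hχd, ← map_pow, ← map_pow, R.d_pow, map_one, map_one]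
  have e₃ : q ^ (2 * F) = 1 := by
    -- In the commutative target the dihedral relation reads `q ^ F = q ^ (F * (n - 1))`;
    -- multiplying by `q ^ F` reduces the claim to `e₂`.
    have := congrArg (fun z => hCharacter hm hn hq β' σ' (φ z)) R.c_d
    simp only [map_mul, map_pow, hχc, hχd] at this
    rw [mul_comm, mul_left_inj' (pow_ne_zero _ hq0)] at this
    rw [mul_comm, pow_mul, pow_two]
    nth_rewrite 1 [this]
    rw [← pow_succ, Nat.sub_add_cancel (by omega), ← pow_mul, mul_comm, e₂]
  refine ⟨f, hf, F, hF, s, hs, t, ht, hgcd, hq.dvd_of_pow_eq_one _ e₁, hq.dvd_of_pow_eq_one _ e₂,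
    hq.dvd_of_pow_eq_one _ e₃, ?_, ?_⟩
  -- The image of `c` commutes with the image of `x` through `β`, and with `x` itself through `σ' ^
  -- s * β' * q⁻¹ ^ f`. The lemma equates these scalars.
  · have h1 := eq_of_qComm_skewPrimitive
      (mem_groupPart_of_isGroupLikeElem ((isGroupLikeElem_of_mem (c_mem_groupPart)).map φ))
      ha hy0 (by simpa only [map_mul, map_smul] using congrArg φ R.c_x)
      (by rw [hc]; exact mul_qComm (mul_qComm (pow_qComm R'.d_x s) (pow_qComm R'.c_x 1))
            (pow_qComm h_mul_x f))
    rw [inv_pow, pow_one, ← div_eq_mul_inv, div_eq_iff (pow_ne_zero _ hq0)] at h1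
    linear_combination -(q ^ f) * hβ - β * h1
  · have h1 := eq_of_qComm_skewPrimitive
      (mem_groupPart_of_isGroupLikeElem ((isGroupLikeElem_of_mem (d_mem_groupPart)).map φ))
      ha hy0 (by simpa only [map_mul, map_smul] using congrArg φ R.d_x)
      (by rw [hd]; exact mul_qComm (mul_qComm (pow_qComm R'.d_x t) (pow_qComm R'.c_x 0))
            (pow_qComm h_mul_x F))
    rw [inv_pow, pow_zero, mul_one, ← div_eq_mul_inv, div_eq_iff (pow_ne_zero _ hq0)] at h1
    linear_combination -(q ^ F) * hσ - σ * h1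

/-! ### Sufficiency: explicit isomorphisms. -/

variable (hm hn hq β' σ') in
/-- The assignment `c ↦ d ^ s c h ^ f`, `d ↦ d ^ t h ^ F`, `h ↦ h`, `x ↦ x`. -/
def twistGen (f F s t : ℕ) : Gen → TaftDihedral hm hn hq β' σ'
  | .c => gen .d ^ s * gen .c * gen .h ^ f
  | .d => gen .d ^ t * gen .h ^ F
  | .h => gen .h
  | .x => gen .x

/-- Each hypothesis serves particular relations: `hf` gives `c ^ 2 = 1`, `hnF` gives `d ^ n = 1`,
`hF` with `hnF` makes `h ^ F` equal to its `(n - 1)`-th power as the dihedral relation needs, and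
`hc`, `hd` match the scalars with `x`. Any `s` is allowed since `d ^ s * c` is always an involution.
-/
theorem respects_twistGen {f F s t : ℕ} (hf : m ∣ 2 * f) (hnF : m ∣ n * F) (hF : m ∣ 2 * F)
    (hc : β' * σ' ^ s = β * q ^ f) (hd : σ' ^ t = σ * q ^ F) :
    Respects m n q β σ (twistGen hm hn hq β' σ' f F s t) := by
  have R := respects_of hm hn hq β' σ'
  have hq0 : q ≠ 0 := hq.ne_zero (by omega)
  have h_pow : ∀ k, m ∣ k → gen .h ^ k = 1 := by
    rintro _ ⟨k, rfl⟩
    rw [pow_mul, R.h_pow, one_pow]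
  have hch : Commute (gen .c) (gen .h) := R.c_h
  have hdh : Commute (gen .d) (gen .h) := R.d_h
  have hwh : Commute (gen .d ^ s * gen .c) (gen .h) := (hdh.pow_left s).mul_left hch
  have hw : SemiconjBy (gen .d ^ s * gen .c) (gen .d) (gen .d ^ (n - 1)) :=
    SemiconjBy.mul_left (((Commute.refl (gen .d)).pow_pow s (n - 1)) : SemiconjBy _ _ _)
      (show SemiconjBy (gen .c) (gen .d) (gen .d ^ (n - 1)) from R.c_d)
  have hcs : gen .c * gen .d ^ s = (gen .d ^ (n - 1)) ^ s * gen .c :=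
    (show SemiconjBy (gen .c) (gen .d) (gen .d ^ (n - 1)) from R.c_d).pow_right s
  constructor <;> simp only [twistGen]
  · rw [(hwh.pow_right f).mul_pow, ← pow_mul, h_pow _ (by rwa [mul_comm]), mul_one, pow_two,
      mul_assoc, ← mul_assoc (gen .c), hcs, mul_assoc, ← pow_two, R.c_pow, mul_one, ← pow_mul,
      ← pow_add]
    obtain ⟨k, rfl⟩ : ∃ k, n = k + 1 := ⟨n - 1, by omega⟩
    rw [Nat.add_sub_cancel, show s + k * s = (k + 1) * s by ring, pow_mul, R.d_pow, one_pow]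
  · rw [(hdh.pow_pow t F).mul_pow, ← pow_mul, ← pow_mul, h_pow _ (by rwa [mul_comm]), mul_comm t,
      pow_mul, R.d_pow, one_pow, one_mul]
  · exact R.h_pow
  · exact R.x_pow
  · exact (hwh.mul_left ((Commute.refl _).pow_left f)).eq
  · exact ((hdh.pow_left t).mul_left ((Commute.refl _).pow_left F)).eq
  · have h1 : (gen .h ^ F) ^ (n - 1) = gen .h ^ F := by
      have h2 : gen .h ^ (F * (n - 1)) * gen .h ^ F = gen .h ^ F * gen .h ^ F := by
        rw [← pow_add, ← pow_add, h_pow (F + F) (by rwa [← two_mul]), h_pow]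
        rwa [← Nat.mul_succ, Nat.succ_eq_add_one, Nat.sub_add_cancel (by omega), mul_comm]
      rw [← pow_mul]
      exact ((isGroupLikeElem_of_mem h_mem_groupPart).isUnit.pow F).mul_right_cancel h2
    rw [(hdh.pow_pow t F).mul_pow, h1, ← pow_mul, mul_comm t, pow_mul]
    exact ((hw.pow_right t).mul_right (hwh.pow_right F)).mul_left
      (((hdh.symm.pow_pow f t).mul_right ((Commute.refl _).pow_pow f F)) : SemiconjBy _ _ _)
  · rw [mul_qComm (mul_qComm (pow_qComm R.d_x s) R.c_x) (pow_qComm h_mul_x f), mul_comm _ β', hc,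
      inv_pow, mul_inv_cancel_right₀ (pow_ne_zero _ hq0)]
  · rw [mul_qComm (pow_qComm R.d_x t) (pow_qComm h_mul_x F), hd, inv_pow,
      mul_inv_cancel_right₀ (pow_ne_zero _ hq0)]
  · exact R.x_h

theorem isGroupLikeElem_twistGen (f F s t : ℕ) {g : Gen} (hg : g ≠ .x) :
    IsGroupLikeElem K (twistGen hm hn hq β' σ' f F s t g) := by
  have hc := isGroupLikeElem_of_mem (c_mem_groupPart (hm := hm) (hn := hn) (hq := hq) (β := β')
    (σ := σ'))
  have hd := isGroupLikeElem_of_mem (d_mem_groupPart (hm := hm) (hn := hn) (hq := hq) (β := β')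
    (σ := σ'))
  have hh := isGroupLikeElem_of_mem (h_mem_groupPart (hm := hm) (hn := hn) (hq := hq) (β := β')
    (σ := σ'))
  cases g
  exacts [(hd.pow.mul hc).mul hh.pow, hd.pow.mul hh.pow, hh, absurd rfl hg]

/-- The composite sends `d` to `d ^ (t' * t) * h ^ (F' * t + F)` and `c` to `d ^ (t' * s + s') * c *
h ^ (F' * s + f' + f)`; the hypotheses say that these are `d` and `c`. -/
theorem twistGen_comp {f F s t f' F' s' t' : ℕ}
    (hR : Respects m n q β' σ' (twistGen hm hn hq β σ f' F' s' t'))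
    (hR' : Respects m n q β σ (twistGen hm hn hq β' σ' f F s t))
    (ht : t' * t ≡ 1 [MOD n]) (hs : n ∣ t' * s + s') (hF : m ∣ F' * t + F)
    (hf : m ∣ F' * s + f' + f) :
    (lift hm hn hq _ hR).comp (lift hm hn hq _ hR') =
      AlgHom.id K (TaftDihedral hm hn hq β σ) := by
  have R := respects_of hm hn hq β σ
  have hdh : Commute (of hm hn hq β σ .d) (of hm hn hq β σ .h) := R.d_h
  have hch : Commute (of hm hn hq β σ .c) (of hm hn hq β σ .h) := R.c_h
  have h_pow : ∀ k, m ∣ k → of hm hn hq β σ .h ^ k = 1 := by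
    rintro _ ⟨k, rfl⟩
    rw [pow_mul, R.h_pow, one_pow]
  have d_pow : ∀ k, n ∣ k → of hm hn hq β σ .d ^ k = 1 := by
    rintro _ ⟨k, rfl⟩
    rw [pow_mul, R.d_pow, one_pow]
  refine algHom_ext fun g => ?_
  cases g <;> simp only [AlgHom.comp_apply, lift_of, twistGen, map_mul, map_pow, AlgHom.id_apply]
  · rw [(hdh.pow_pow t' F').mul_pow, ← pow_mul, ← pow_mul]
    calc of hm hn hq β σ .d ^ (t' * s) * of hm hn hq β σ .h ^ (F' * s) *
          (of hm hn hq β σ .d ^ s' * of hm hn hq β σ .c * of hm hn hq β σ .h ^ f') *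
            of hm hn hq β σ .h ^ f
        = of hm hn hq β σ .d ^ (t' * s) * (of hm hn hq β σ .h ^ (F' * s) *
          (of hm hn hq β σ .d ^ s' * of hm hn hq β σ .c)) *
            (of hm hn hq β σ .h ^ f' * of hm hn hq β σ .h ^ f) := by simp only [mul_assoc]
      _ = of hm hn hq β σ .d ^ (t' * s + s') * of hm hn hq β σ .c *
            of hm hn hq β σ .h ^ (F' * s + f' + f) := by
          rw [(((hdh.pow_left s').mul_left hch).pow_right (F' * s)).eq.symm]
          simp only [pow_add, mul_assoc]
      _ = of hm hn hq β σ .c := by rw [d_pow _ hs, h_pow _ hf, one_mul, mul_one]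
  · rw [(hdh.pow_pow t' F').mul_pow, ← pow_mul, ← pow_mul, mul_assoc, ← pow_add, h_pow _ hF,
      mul_one, pow_eq_pow_mod _ R.d_pow, ht, ← pow_eq_pow_mod _ R.d_pow, pow_one]

theorem nonempty_equiv_of_parameters (hβ : β ^ 2 = 1) (hβ' : β' ^ 2 = 1) (hσ : σ ^ 2 = 1)
    (hσ' : σ' ^ 2 = 1) (hσn : σ ^ n = 1) (hσn' : σ' ^ n = 1) {f F s t : ℕ} (ht : Nat.gcd t n = 1)
    (hf : m ∣ 2 * f) (hnF : m ∣ n * F) (hF : m ∣ 2 * F) (hc : q ^ f = β * β' * σ' ^ s)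
    (hd : q ^ F = σ * σ' ^ t) :
    Nonempty (TaftDihedral hm hn hq β σ ≃ₐc[K] TaftDihedral hm hn hq β' σ') := by
  obtain ⟨t', ht'⟩ : ∃ t', t * t' ≡ 1 [MOD n] := by
    obtain ⟨y, -, hy⟩ := Nat.exists_mul_mod_eq_one_of_coprime (k := n) (n := t) ht (by omega)
    exact ⟨y, by rw [Nat.ModEq, hy, Nat.mod_eq_of_lt (by omega)]⟩
  have pow_congr : ∀ r : K, r ^ n = 1 → r ^ (t * t') = r := fun r hr => by
    rw [pow_eq_pow_mod _ hr, ht', ← pow_eq_pow_mod _ hr, pow_one]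
  have hdF : q ^ (t' * F) = σ' * σ ^ t' := by
    rw [mul_comm t', pow_mul, hd, mul_pow, ← pow_mul, pow_congr σ' hσn', mul_comm]
  have sq_pow : ∀ (r : K) (i : ℕ), r ^ 2 = 1 → r ^ i * r ^ i = 1 := fun r i hr => by
    rw [← pow_add, ← two_mul, pow_mul, hr, one_pow]
  -- Here `l = n - 1` plays the role of `-1` in exponents modulo `n`.
  obtain ⟨l, hl⟩ : ∃ l, n = l + 1 := ⟨n - 1, by omega⟩
  have hnd : n ∣ t * t' + l := by
    have h1 : t * t' + l ≡ 1 + l [MOD n] := ht'.add_right l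
    rw [add_comm 1, ← hl] at h1
    exact (Nat.modEq_zero_iff_dvd.mp (h1.trans (by simp [Nat.ModEq])))
  have hσl : σ ^ l = σ := by
    have h1 : σ ^ l * σ = σ * σ := by rw [← pow_succ, ← hl, hσn, ← pow_two, hσ]
    exact mul_right_cancel₀ (fun h => by simp [h] at hσ) h1
  have R₁ : Respects m n q β σ (twistGen hm hn hq β' σ' f F s t) := by
    refine respects_twistGen hf hnF hF ?_ ?_
    · linear_combination -(β * hc) - β' * σ' ^ s * hβ
    · linear_combination -(σ * hd) - σ' ^ t * hσ
  -- The parameters solve the congruences of `twistGen_comp`: the inverse of `t`, then `-t' * F`,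
  -- `-t' * s` and `-(f + F' * s)` with `F' = t' * F`. Signs modulo `m` disappear because `m`
  -- divides `2 * f` and `2 * F`; modulo `n` the sign is `l`.
  have R₂ : Respects m n q β' σ'
      (twistGen hm hn hq β σ (t' * F * s + f) (t' * F) (l * t' * s) t') := by
    refine respects_twistGen ?_ ?_ ?_ ?_ ?_
    · rw [mul_add, show 2 * (t' * F * s) = 2 * F * (t' * s) by ring]
      exact dvd_add (hF.mul_right _) hf
    · rw [show n * (t' * F) = n * F * t' by ring]
      exact hnF.mul_right _
    · rw [show 2 * (t' * F) = 2 * F * t' by ring]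
      exact hF.mul_right _
    · rw [pow_add, pow_mul q, hdF, hc, mul_assoc l, pow_mul σ l, hσl, mul_pow, ← pow_mul]
      linear_combination -(β * σ ^ (t' * s) * β' ^ 2) * sq_pow σ' s hσ' - β * σ ^ (t' * s) * hβ'
    · rw [hdF]
      linear_combination -(σ ^ t') * hσ'
  refine ⟨BialgEquiv.ofAlgEquiv
    (AlgEquiv.ofAlgHom (lift hm hn hq _ R₁) (lift hm hn hq _ R₂)
      (twistGen_comp _ _ ?_ ?_ ?_ ?_) (twistGen_comp _ _ ?_ ?_ ?_ ?_))
    (algHom_ext fun g => ?_) (algHom_ext fun g => ?_)⟩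
  · exact ht'
  · rw [show t * (l * t' * s) + s = (t * t' * l + 1) * s by ring]
    refine Dvd.dvd.mul_right ?_ _
    have h1 : n ∣ (t * t' + l) * l + (l + 1) := dvd_add (hnd.mul_right _) (by rw [hl])
    have h2 : (t * t' + l) * l + (l + 1) = (t * t' * l + 1) + (l + 1) * l := by ring
    rw [h2] at h1
    exact (Nat.dvd_add_left (by rw [hl]; exact dvd_mul_right _ _)).mp h1
  · rw [show F * t' + t' * F = 2 * F * t' by ring]
    exact hF.mul_right _
  · rw [show F * (l * t' * s) + f + (t' * F * s + f) = (l + 1) * F * (t' * s) + 2 * f by ring, ← hl]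
    exact dvd_add (hnF.mul_right _) hf
  · rwa [mul_comm]
  · rw [show t' * s + l * t' * s = (l + 1) * (t' * s) by ring, ← hl]
    exact dvd_mul_right _ _
  -- The product `t * t'` is known only modulo `n`, but divisibility by `m` is wanted; `m ∣ n * F`
  -- bridges the two moduli.
  · obtain ⟨k, hk⟩ := hnd
    have h1 : t' * F * t + F + n * F = n * F * k + 2 * F := by
      rw [show n * F * k = n * k * F by ring, ← hk]
      nth_rewrite 1 [hl]
      ring
    exact (Nat.dvd_add_left hnF).mp (h1 ▸ dvd_add (hnF.mul_right _) hF)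
  · rw [show t' * F * s + (t' * F * s + f) + f = 2 * F * (t' * s) + 2 * f by ring]
    exact dvd_add (hF.mul_right _) hf
  · have hG := fun g => isGroupLikeElem_twistGen (hm := hm) (hn := hn) (hq := hq) (β' := β')
      (σ' := σ') f F s t (g := g)
    cases g <;> simp [counit_of, counitGen, hG]
    simp [twistGen, counit_of, counitGen]
  · have hG := fun g => isGroupLikeElem_twistGen (hm := hm) (hn := hn) (hq := hq) (β' := β')
      (σ' := σ') f F s t (g := g)
    cases g <;> simp [comul_of, comulGen, hG]
    simp [twistGen, comul_of, comulGen]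

end Isomorphisms

end TaftDihedral

theorem mainTheorem4 {K : Type*} [Field K] {m n : ℕ} (hm : 2 ≤ m) (hn : 3 ≤ n)
    {q : K} (hq : IsPrimitiveRoot q m) (β β' σ σ' : K)
    (hβ : β ^ 2 = 1) (hβ' : β' ^ 2 = 1)
    (hσ : σ ^ Nat.gcd n (n - 2) = 1) (hσ' : σ' ^ Nat.gcd n (n - 2) = 1) :
    Nonempty (TaftDihedral hm hn hq β σ ≃ₐc[K] TaftDihedral hm hn hq β' σ') ↔
      ∃ f < m, ∃ F < m, ∃ s < n, ∃ t < n, Nat.gcd t n = 1 ∧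
        m ∣ 2 * f ∧ m ∣ n * F ∧ m ∣ 2 * F ∧
        q ^ f = β * β' * σ' ^ s ∧ q ^ F = σ * σ' ^ t := by
  have pow_of_dvd : ∀ {r : K} {k l : ℕ}, r ^ k = 1 → k ∣ l → r ^ l = 1 := by
    rintro r k _ hr ⟨l, rfl⟩
    rw [pow_mul, hr, one_pow]
  have hn_dvd : Nat.gcd n (n - 2) ∣ n := Nat.gcd_dvd_left _ _
  -- The gcd divides `n - (n - 2) = 2`, so both `σ` and `σ'` have square and `n`-th power equal to
  -- `1`.
  have h2_dvd : Nat.gcd n (n - 2) ∣ 2 := by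
    have := Nat.dvd_sub hn_dvd (Nat.gcd_dvd_right n (n - 2))
    rwa [Nat.sub_sub_self (by omega)] at this
  constructor
  · rintro ⟨φ⟩
    exact TaftDihedral.exists_parameters_of_equiv φ hβ hβ' (pow_of_dvd hσ h2_dvd)
      (pow_of_dvd hσ' h2_dvd) (pow_of_dvd hσ' hn_dvd)
  · rintro ⟨f, -, F, -, s, -, t, -, ht, hf, hnF, hF, hc, hd⟩
    exact TaftDihedral.nonempty_equiv_of_parameters hβ hβ' (pow_of_dvd hσ h2_dvd)
      (pow_of_dvd hσ' h2_dvd) (pow_of_dvd hσ hn_dvd) (pow_of_dvd hσ' hn_dvd) ht hf hnF hF hc hd
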